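/- **Theorem (the smallest singular value).** Let $n>m\ge 1$ be integers, let $A\in\mathbb{R}^{n\times m}$ be a random matrix with i.i.d. standard normal entries, and let $\lambda=1-\frac{m}{n}\in(0,1)$. Let $W_0$ denote the principal branch of the Lambert $W$ function, i.e. for $z\ge -e^{-1}$, $W_0(z)$ is the unique $w\ge -1$ with $we^{w}=z$. For $\alpha>0$ and $\epsilon\in(0,1)$ put $$\mu_\alpha(\epsilon)=\alpha+\ln(1+2\epsilon^{-1}),$$ $$r(\mu,\lambda)=(1-\lambda)^{-\frac12}+1+\sqrt{2\mu},\qquad q(\mu,\lambda)=-(1-\lambda)^{-1}W_0\!\left(-e^{-2\mu(1-\lambda)-\frac65}\right).$$ Then for every $\alpha>0$ the supremum $$p(\alpha,\lambda)=\sup_{\epsilon\in(0,1)}\left[\sqrt{q(\mu_\alpha(\epsilon),\lambda)}-\epsilon\, r(\mu_\alpha(\epsilon),\lambda)\right]$$ is finite and strictly positive, and the smallest singular value $s_{\min}(A)$ satisfies $$\mathbb{P}\left(s_{\min}(A)\le p(\alpha,\lambda)\sqrt{m}\right)\le 2e^{-\alpha m}.$$ -/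

import Mathlib

open MeasureTheory ProbabilityTheory

/-- The principal branch `W₀` of the Lambert `W` function: for `z ≥ -e⁻¹` it is the unique
`w ≥ -1` with `w * exp w = z` (a junk value is taken for `z < -e⁻¹`). -/
noncomputable def lambertW0 (z : ℝ) : ℝ :=
  Function.invFunOn (fun w : ℝ => w * Real.exp w) (Set.Ici (-1)) z

/-- `W₀ z` is at least `-1` and solves `w * exp w = z`, for every `z ≥ -e⁻¹`. -/
theorem lambertW0_spec {z : ℝ} (hz : -Real.exp (-1) ≤ z) :
    -1 ≤ lambertW0 z ∧ lambertW0 z * Real.exp (lambertW0 z) = z := by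
  have hex : ∃ w ∈ Set.Ici (-1 : ℝ), (fun w : ℝ => w * Real.exp w) w = z := by
    have hb : z ≤ max z 0 * Real.exp (max z 0) := by
      have h0 : (0 : ℝ) ≤ max z 0 := le_max_right _ _
      have h1 : 1 ≤ Real.exp (max z 0) := Real.one_le_exp h0
      have h2 : z ≤ max z 0 := le_max_left _ _
      nlinarith
    have hle : (-1 : ℝ) ≤ max z 0 := le_trans (by norm_num) (le_max_right z 0)
    have hc : ContinuousOn (fun w : ℝ => w * Real.exp w) (Set.Icc (-1) (max z 0)) := by
      fun_prop
    obtain ⟨w, hw, hwz⟩ := intermediate_value_Icc hle hc ⟨by simpa using hz, hb⟩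
    exact ⟨w, hw.1, hwz⟩
  exact ⟨Function.invFunOn_mem hex, Function.invFunOn_eq hex⟩

/-- `μ_α(ε) = α + ln (1 + 2 ε⁻¹)`. -/
noncomputable def muEps (α ε : ℝ) : ℝ := α + Real.log (1 + 2 * ε⁻¹)

/-- `r(μ, λ) = (1 - λ)^(-1/2) + 1 + √(2 μ)`. -/
noncomputable def rBound (μ lam : ℝ) : ℝ :=
  (1 - lam) ^ (-(1 / 2) : ℝ) + 1 + Real.sqrt (2 * μ)

/-- `q(μ, λ) = -(1 - λ)⁻¹ W₀(-exp (-2 μ (1 - λ) - 6/5))`. -/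
noncomputable def qBound (μ lam : ℝ) : ℝ :=
  -((1 - lam)⁻¹ * lambertW0 (-Real.exp (-2 * μ * (1 - lam) - 6 / 5)))

/-- `√(q(μ_α(ε), λ)) - ε r(μ_α(ε), λ)`, the quantity maximized over `ε`. -/
noncomputable def pEps (α lam ε : ℝ) : ℝ :=
  Real.sqrt (qBound (muEps α ε) lam) - ε * rBound (muEps α ε) lam

/-- `p(α, λ)`, the supremum over `ε ∈ (0, 1)`. -/
noncomputable def pBound (α lam : ℝ) : ℝ :=
  sSup (pEps α lam '' Set.Ioo 0 1)

/-- The smallest singular value of a real `n × m` matrix: the last one of the `min n m` singular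
values, in nonincreasing order with index starting at `0`, of the induced linear map between
Euclidean spaces. -/
noncomputable def sMin {n m : ℕ} (A : Matrix (Fin n) (Fin m) ℝ) : ℝ :=
  (Matrix.toEuclideanLin A).singularValues (min n m - 1)

/-! ### Chi-square tails for `A x` at a fixed unit vector -/

section GaussianTails

variable {Ω : Type*} [MeasurableSpace Ω] {P : Measure Ω}

/-! The matrix is tested on an `ε`-net of the unit sphere with at most `(1 + 2/ε)^m` points. For a
fixed unit `x` the coordinates of `A x` are i.i.d. standard normal, so Chernoff bounds control `‖A
x‖` from both sides. Since `μ_α(ε)` contains the entropy `log (1 + 2/ε)` of the net, each of the two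
union bounds costs only `e^{-αm}`. Off these events `q m < ‖A c‖²` and `‖A c‖ < (r - 1) √m` at every
net point `c`.

The passage to singular values works with squares (`LinearMap.lt_sq_singularValues_of_net`). A net
point near the last right singular vector has component at least `δ = 1 - ε²/2` along it, so its `‖A
c‖²` exceeds `s_min²` by at most `s_max² (1 - δ²)`; the same net gives `s_max < (r - 1) √m / δ`.

It remains to see that `(√q - ε r)² ≤ q - ((r - 1)/δ)² (1 - δ²)` (`sq_pEps_le_of_isMaxOn`). If `r -
1 ≤ δ r`, then `ε r < √q` suffices. Otherwise `m/n ≤ 1/16`, and comparing a maximizer `ε` with `ε/2`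
yields the stronger `ε r ≤ √q / 2` (`mul_rBound_le_of_isMaxOn`). This is why the supremum is first
shown to be attained (`exists_isMaxOn_pEps`). -/

theorem mgf_sq_of_hasLaw_gaussianReal {X : Ω → ℝ} (hX : HasLaw X (gaussianReal 0 1) P)
    {s : ℝ} (hs : 2 * s < 1) :
    mgf (fun ω => X ω ^ 2) P s = (Real.sqrt (1 - 2 * s))⁻¹ := by
  have h1 : mgf (fun ω => X ω ^ 2) P s = ∫ x, Real.exp (s * x ^ 2) ∂(gaussianReal 0 1) := by
    rw [← hX.map_eq, integral_map hX.aemeasurable (by fun_prop)]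
    rfl
  have h2 : ∀ x : ℝ, gaussianPDFReal 0 1 x • Real.exp (s * x ^ 2) =
      (Real.sqrt (2 * Real.pi))⁻¹ * Real.exp (-((1 - 2 * s) / 2) * x ^ 2) := by
    intro x
    rw [gaussianPDFReal_def, smul_eq_mul, mul_assoc, ← Real.exp_add]
    simp only [NNReal.coe_one, mul_one, sub_zero]
    ring_nf
  have hpos : 0 < 1 - 2 * s := by linarith
  rw [h1, integral_gaussianReal_eq_integral_smul one_ne_zero]
  simp_rw [h2]
  rw [integral_const_mul, integral_gaussian, ← Real.sqrt_inv, ← Real.sqrt_inv,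
    ← Real.sqrt_mul (by positivity)]
  congr 1
  field_simp

variable {n m : ℕ} {A : Ω → Matrix (Fin n) (Fin m) ℝ}

theorem hasLaw_sum_mul_gaussianReal
    {ι : Type*} [Fintype ι] {g : ι → Ω → ℝ} (hlaw : ∀ i, HasLaw (g i) (gaussianReal 0 1) P)
    (hindep : iIndepFun g P) (x : ι → ℝ) (hx : ∑ j, x j ^ 2 = 1) :
    HasLaw (fun ω => ∑ j, g j ω * x j) (gaussianReal 0 1) P := by
  have := hindep.isProbabilityMeasure
  have hm : ∀ j, AEMeasurable (fun ω => g j ω * x j) P := fun j =>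
    (hlaw j).aemeasurable.mul_const _
  refine ⟨by fun_prop, ?_⟩
  have hind : iIndepFun (fun j ω => g j ω * x j) P :=
    hindep.comp (fun j y => y * x j) (fun j => by fun_prop)
  apply Measure.ext_of_charFun
  rw [hind.charFun_map_fun_sum_eq_prod hm]
  ext u
  rw [Finset.prod_apply]
  simp_rw [fun j => (gaussianReal_mul_const (hlaw j) (x j)).map_eq, charFun_gaussianReal]
  rw [← Complex.exp_sum]
  congr 1
  have : ∑ j, (x j : ℂ) ^ 2 = 1 := by exact_mod_cast hx
  simp [← Finset.sum_mul, ← Finset.sum_div, this]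

/-- The row sums are a linear image of a Gaussian vector, hence jointly Gaussian, so vanishing
covariances between distinct rows give independence. -/
theorem iIndepFun_sum_mul_row
    (hlaw : ∀ i j, HasLaw (fun ω => A ω i j) (gaussianReal 0 1) P)
    (hindep : iIndepFun (fun (ij : Fin n × Fin m) (ω : Ω) => A ω ij.1 ij.2) P) (x : Fin m → ℝ) :
    iIndepFun (fun (i : Fin n) ω => ∑ j, A ω i j * x j) P := by
  have := hindep.isProbabilityMeasure
  have hG : ∀ ij : Fin n × Fin m, HasGaussianLaw (fun ω => A ω ij.1 ij.2) P := fun ij =>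
    (hlaw ij.1 ij.2).hasGaussianLaw
  have hjoint := hindep.hasGaussianLaw hG
  let L : (Fin n × Fin m → ℝ) →L[ℝ] (Fin n → ℝ) :=
    ContinuousLinearMap.pi fun i => ∑ j, (x j) • ContinuousLinearMap.proj (R := ℝ) (i, j)
  have hL := hjoint.map_fun L
  refine HasGaussianLaw.iIndepFun_of_covariance_eq_zero (by
    convert! hL using 3 with ω i
    simp [L, mul_comm]) ?_
  intro i k hik
  have hm2 : ∀ i j, MemLp (fun ω => A ω i j * x j) 2 P := fun i j =>
    (hG (i, j)).memLp_two.mul_const _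
  rw [covariance_fun_sum_fun_sum (hm2 i) (hm2 k)]
  refine Finset.sum_eq_zero fun a _ => Finset.sum_eq_zero fun b _ => ?_
  rw [covariance_mul_const_left, covariance_mul_const_right,
    (hindep.indepFun (i := (i, a)) (j := (k, b)) (by simp [hik])).covariance_eq_zero
      (hG (i, a)).memLp_two (hG (k, b)).memLp_two]
  simp

variable {ι : Type*} [Fintype ι] {g : ι → Ω → ℝ}

theorem mgf_sum_sq_gaussian (hlaw : ∀ i, HasLaw (g i) (gaussianReal 0 1) P)
    (hindep : iIndepFun g P) {s : ℝ} (hs : 2 * s < 1) :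
    mgf (fun ω => ∑ i, g i ω ^ 2) P s = (Real.sqrt (1 - 2 * s))⁻¹ ^ Fintype.card ι := by
  have hind : iIndepFun (fun i ω => g i ω ^ 2) P :=
    hindep.comp (fun i y => y ^ 2) (fun i => by fun_prop)
  have h := hind.mgf_sum₀ (t := s) (fun i => (hlaw i).aemeasurable.pow_const 2) Finset.univ
  have he : (fun ω => ∑ i, g i ω ^ 2) = ∑ i, fun ω => g i ω ^ 2 := by ext; simp
  rw [he, h]
  simp_rw [fun i => mgf_sq_of_hasLaw_gaussianReal (hlaw i) hs]
  simp

theorem integrable_exp_sum_sq_gaussian (hlaw : ∀ i, HasLaw (g i) (gaussianReal 0 1) P)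
    (hindep : iIndepFun g P) {s : ℝ} (hs : 2 * s < 1) :
    Integrable (fun ω => Real.exp (s * ∑ i, g i ω ^ 2)) P := by
  have := hindep.isProbabilityMeasure
  refine (mgf_pos_iff (X := fun ω => ∑ i, g i ω ^ 2)).1 ?_
  rw [mgf_sum_sq_gaussian hlaw hindep hs]
  have : 0 < 1 - 2 * s := by linarith
  positivity

theorem inv_sqrt_exp_pow (b : ℝ) (k : ℕ) :
    (Real.sqrt (Real.exp b))⁻¹ ^ k = Real.exp (-b / 2 * k) := by
  rw [← Real.exp_half, ← Real.exp_neg, ← Real.exp_nat_mul]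
  ring_nf

/-- Lower tail of the chi-square distribution. -/
theorem measureReal_sum_sq_gaussian_le (hlaw : ∀ i, HasLaw (g i) (gaussianReal 0 1) P)
    (hindep : iIndepFun g P) {t : ℝ} (ht : 0 < t) (ht1 : t ≤ 1) :
    P.real {ω | ∑ i, g i ω ^ 2 ≤ t * Fintype.card ι} ≤
      Real.exp ((1 - t + Real.log t) / 2 * Fintype.card ι) := by
  have := hindep.isProbabilityMeasure
  have hinv : 1 ≤ t⁻¹ := (one_le_inv₀ ht).2 ht1
  -- The optimal Chernoff parameter solves `1 - 2 s = 1 / t`.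
  have hs : 2 * ((1 - t⁻¹) / 2) < 1 := by linarith [inv_pos.2 ht]
  refine (measure_le_le_exp_mul_mgf _ (by linarith)
    (integrable_exp_sum_sq_gaussian hlaw hindep hs)).trans (le_of_eq ?_)
  rw [mgf_sum_sq_gaussian hlaw hindep hs,
    show 1 - 2 * ((1 - t⁻¹) / 2) = Real.exp (-Real.log t) by
      rw [Real.exp_neg, Real.exp_log ht]; ring, inv_sqrt_exp_pow, ← Real.exp_add]
  congr 1
  field_simp
  ring

/-- Upper tail of the chi distribution. -/
theorem measureReal_add_sq_le_sum_sq_gaussian (hlaw : ∀ i, HasLaw (g i) (gaussianReal 0 1) P)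
    (hindep : iIndepFun g P) [Nonempty ι] {τ : ℝ} (hτ : 0 ≤ τ) :
    P.real {ω | (Real.sqrt (Fintype.card ι) + τ) ^ 2 ≤ ∑ i, g i ω ^ 2} ≤
      Real.exp (-τ ^ 2 / 2) := by
  have := hindep.isProbabilityMeasure
  set N : ℝ := ((Fintype.card ι : ℕ) : ℝ) with hN
  have hN0 : 0 < N := by rw [hN]; exact_mod_cast Fintype.card_pos
  have hq0 : 0 < Real.sqrt N := Real.sqrt_pos.2 hN0
  set b : ℝ := τ / Real.sqrt N with hb
  have hτb : τ = b * Real.sqrt N := by rw [hb]; field_simp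
  have hb0 : 0 ≤ b := by positivity
  have ha : 0 < 1 + b := by linarith
  -- Again the optimal parameter, now for the threshold `(1 + b)² N`; `log (1 + b) ≤ b` then leaves
  -- the exponent `-b² N / 2`.
  set s : ℝ := (1 - ((1 + b) ^ 2)⁻¹) / 2 with hsdef
  have hinv : ((1 + b) ^ 2)⁻¹ ≤ 1 := inv_le_one_of_one_le₀ (by nlinarith)
  have hs : 2 * s < 1 := by
    have : 0 < ((1 + b) ^ 2)⁻¹ := by positivity
    rw [hsdef]; linarith
  refine (measure_ge_le_exp_mul_mgf _ (by rw [hsdef]; linarith)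
    (integrable_exp_sum_sq_gaussian hlaw hindep hs)).trans ?_
  have hexp : 1 - 2 * s = Real.exp (-(2 * Real.log (1 + b))) := by
    rw [Real.exp_neg, two_mul (Real.log (1 + b)), Real.exp_add, Real.exp_log ha, hsdef]; ring
  rw [mgf_sum_sq_gaussian hlaw hindep hs, hexp, inv_sqrt_exp_pow, ← Real.exp_add]
  apply Real.exp_le_exp.2
  have hsq : Real.sqrt N ^ 2 = N := Real.sq_sqrt hN0.le
  have e1 : (Real.sqrt N + τ) ^ 2 = (1 + b) ^ 2 * N := by
    rw [hτb]; linear_combination (1 + b) ^ 2 * hsq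
  have e2 : τ ^ 2 = b ^ 2 * N := by rw [hτb, mul_pow, hsq]
  have e3 : s * (1 + b) ^ 2 = ((1 + b) ^ 2 - 1) / 2 := by
    rw [hsdef]; field_simp
  have hlog : Real.log (1 + b) ≤ b := by linarith [Real.log_le_sub_one_of_pos ha]
  rw [e1, e2, ← hN]
  have : -s * ((1 + b) ^ 2 * N) = -(((1 + b) ^ 2 - 1) / 2) * N := by rw [← e3]; ring
  rw [this]
  nlinarith

end GaussianTails

/-! ### Nets of the unit sphere -/

section SphereNet

variable {E : Type*} [NormedAddCommGroup E] [NormedSpace ℝ E] [FiniteDimensional ℝ E]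

open Metric Module in
-- Volume comparison: the balls of radius `ε / 2` around the points are disjoint and lie in the ball
-- of radius `1 + ε / 2`.
theorem card_le_of_separated_of_norm_eq_one {ε : ℝ} (hε : 0 < ε) (s : Finset E)
    (hs : ∀ c ∈ s, ‖c‖ = 1) (h : ∀ c ∈ s, ∀ d ∈ s, c ≠ d → ε < ‖c - d‖) :
    (s.card : ℝ) ≤ (1 + 2 * ε⁻¹) ^ finrank ℝ E := by
  borelize E
  let μ : Measure E := Measure.addHaar
  have hδ : 0 < ε / 2 := by positivity
  have hρ : 0 < 1 + ε / 2 := by positivity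
  have D : Set.Pairwise (s : Set E) (Function.onFun Disjoint fun c => ball (c : E) (ε / 2)) := by
    rintro c hc d hd hcd
    apply ball_disjoint_ball
    rw [dist_eq_norm]
    linarith [h c hc d hd hcd]
  have hsub : (⋃ c ∈ s, ball (c : E) (ε / 2)) ⊆ ball (0 : E) (1 + ε / 2) := by
    refine Set.iUnion₂_subset fun x hx => ball_subset_ball' ?_
    rw [dist_zero_right, hs x hx]
    linarith
  have I : (s.card : ENNReal) * ENNReal.ofReal ((ε / 2) ^ finrank ℝ E) * μ (ball 0 1) ≤
      ENNReal.ofReal ((1 + ε / 2) ^ finrank ℝ E) * μ (ball 0 1) := by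
    rw [← μ.addHaar_ball_of_pos 0 hρ]
    refine le_trans (le_of_eq ?_) (measure_mono hsub)
    rw [measure_biUnion_finset D fun c _ => measurableSet_ball]
    simp only [μ.addHaar_ball_of_pos _ hδ, Finset.sum_const, nsmul_eq_mul, mul_assoc]
  have J := (ENNReal.mul_le_mul_iff_left (measure_ball_pos _ _ zero_lt_one).ne'
    measure_ball_lt_top.ne).1 I
  have K := ENNReal.toReal_le_of_le_ofReal (by positivity) J
  rw [ENNReal.toReal_mul, ENNReal.toReal_natCast, ENNReal.toReal_ofReal (by positivity)] at K
  rw [← le_div_iff₀ (by positivity), ← div_pow] at K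
  refine K.trans_eq (congrArg (· ^ _) ?_)
  field_simp
  ring

/-- The unit sphere of a normed space of dimension `k` has an `ε`-net with at most `(1 + 2 / ε) ^ k`
points. -/
theorem exists_sphere_net {ε : ℝ} (hε : 0 < ε) :
    ∃ s : Finset E, (∀ c ∈ s, ‖c‖ = 1) ∧
      (s.card : ℝ) ≤ (1 + 2 * ε⁻¹) ^ Module.finrank ℝ E ∧
      ∀ v : E, ‖v‖ = 1 → ∃ c ∈ s, ‖v - c‖ ≤ ε := by
  classical
  let Q : Finset E → Prop := fun s =>
    (∀ c ∈ s, ‖c‖ = 1) ∧ ∀ c ∈ s, ∀ d ∈ s, c ≠ d → ε < ‖c - d‖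
  let K : Set ℕ := {k | ∃ s, Q s ∧ s.card = k}
  have hne : K.Nonempty := ⟨0, ∅, by simp [Q], rfl⟩
  have hbdd : BddAbove K := by
    refine ⟨⌊(1 + 2 * ε⁻¹) ^ Module.finrank ℝ E⌋₊, ?_⟩
    rintro k ⟨s, hs, rfl⟩
    exact Nat.le_floor (card_le_of_separated_of_norm_eq_one hε s hs.1 hs.2)
  -- A separated set of maximal cardinality is a net: a point far from all of it could be added.
  obtain ⟨s, hs, hcard⟩ := Nat.sSup_mem hne hbdd
  refine ⟨s, hs.1, card_le_of_separated_of_norm_eq_one hε s hs.1 hs.2, fun v hv => ?_⟩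
  by_contra! hfar
  have hvs : v ∉ s := fun hmem => by
    have := hfar v hmem
    simp at this
    linarith
  have hins : (insert v s).card ∈ K := by
    refine ⟨insert v s, ⟨?_, ?_⟩, rfl⟩
    · intro c hc
      rcases Finset.mem_insert.1 hc with rfl | hc
      · exact hv
      · exact hs.1 c hc
    · intro c hc d hd hcd
      rcases Finset.mem_insert.1 hc with rfl | hcs <;> rcases Finset.mem_insert.1 hd with rfl | hds
      · exact absurd rfl hcd
      · exact hfar d hds
      · rw [norm_sub_rev]; exact hfar c hcs
      · exact hs.2 c hcs d hds hcd
  have := le_csSup hbdd hins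
  rw [Finset.card_insert_of_notMem hvs] at this
  omega

end SphereNet

/-! ### From a net to the smallest singular value -/

namespace LinearMap

variable {E F : Type*} [NormedAddCommGroup E] [InnerProductSpace ℝ E] [FiniteDimensional ℝ E]
  [NormedAddCommGroup F] [InnerProductSpace ℝ F] [FiniteDimensional ℝ F] (T : E →ₗ[ℝ] F)

/-- The orthonormal basis of right singular vectors diagonalizes `‖T x‖ ^ 2`. -/
theorem exists_orthonormalBasis_sq_norm_apply {k : ℕ} (hk : Module.finrank ℝ E = k) :
    ∃ b : OrthonormalBasis (Fin k) ℝ E, ∀ x,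
      ‖T x‖ ^ 2 = ∑ i : Fin k, T.singularValues i ^ 2 * inner ℝ (b i) x ^ 2 := by
  refine ⟨T.isSymmetric_adjoint_comp_self.eigenvectorBasis hk, fun x => ?_⟩
  set b := T.isSymmetric_adjoint_comp_self.eigenvectorBasis hk with hb
  rw [← real_inner_self_eq_norm_sq, ← LinearMap.adjoint_inner_right, ← b.sum_inner_mul_inner]
  refine Finset.sum_congr rfl fun i _ => ?_
  have h1 := T.isSymmetric_adjoint_comp_self.eigenvectorBasis_apply_self_apply hk x i
  rw [← hb, b.repr_apply_apply, b.repr_apply_apply] at h1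
  simp only [LinearMap.comp_apply, RCLike.ofReal_real_eq_id, id_eq] at h1
  rw [h1, T.sq_singularValues_fin hk, real_inner_comm]
  ring

/-- Lower bound on the smallest singular value from bounds of `‖T x‖` on a net of the sphere; the
defect is of second order in the mesh `ε`. -/
theorem lt_sq_singularValues_of_net {k : ℕ} (hk : Module.finrank ℝ E = k) (hk0 : 0 < k)
    {ε a U : ℝ} (hε1 : ε < 1) (hε : 0 < ε) (s : Finset E) (hs : ∀ c ∈ s, ‖c‖ = 1)
    (hnet : ∀ v : E, ‖v‖ = 1 → ∃ c ∈ s, ‖v - c‖ ≤ ε)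
    (hlow : ∀ c ∈ s, a < ‖T c‖ ^ 2) (hup : ∀ c ∈ s, ‖T c‖ < U) :
    a - (U / (1 - ε ^ 2 / 2)) ^ 2 * (1 - (1 - ε ^ 2 / 2) ^ 2) < T.singularValues (k - 1) ^ 2 := by
  obtain ⟨b, hb⟩ := T.exists_orthonormalBasis_sq_norm_apply hk
  set δ := 1 - ε ^ 2 / 2 with hδ
  have hδ0 : 0 < δ := by rw [hδ]; nlinarith
  have hδ1 : δ ≤ 1 := by rw [hδ]; nlinarith
  -- For unit vectors `‖b i - c‖² = 2 - 2 ⟪b i, c⟫`, so the loss in the inner product is quadratic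
  -- in `ε`.
  have hnear : ∀ i : Fin k, ∃ c ∈ s, δ ≤ inner ℝ (b i) c := by
    intro i
    obtain ⟨c, hc, hd⟩ := hnet (b i) (b.norm_eq_one i)
    refine ⟨c, hc, ?_⟩
    have h1 := norm_sub_sq_real (b i) c
    rw [b.norm_eq_one, hs c hc] at h1
    have h2 : ‖b i - c‖ ^ 2 ≤ ε ^ 2 := by gcongr
    rw [hδ]; linarith
  have hS0 := T.singularValues_nonneg 0
  have hS : T.singularValues 0 < U / δ := by
    obtain ⟨c, hc, hd⟩ := hnear ⟨0, hk0⟩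
    have h1 : T.singularValues 0 ^ 2 * inner ℝ (b ⟨0, hk0⟩) c ^ 2 ≤ ‖T c‖ ^ 2 := by
      rw [hb c]
      exact Finset.single_le_sum (f := fun i : Fin k => T.singularValues i ^ 2 * inner ℝ (b i) c ^ 2)
        (fun i _ => by positivity) (Finset.mem_univ ⟨0, hk0⟩)
    have h2 : (T.singularValues 0 * δ) ^ 2 ≤ ‖T c‖ ^ 2 := by
      refine le_trans ?_ h1
      rw [mul_pow]
      gcongr
    have h3 := abs_le_of_sq_le_sq' h2 (norm_nonneg _)
    rw [lt_div_iff₀ hδ0]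
    linarith [h3.2, hup c hc]
  obtain ⟨c, hc, hd⟩ := hnear ⟨k - 1, by omega⟩
  set j : Fin k := ⟨k - 1, by omega⟩ with hj
  have hsum : ∑ i, inner ℝ (b i) c ^ 2 = 1 := by
    rw [b.sum_sq_inner_right, hs c hc]; norm_num
  have hcj : inner ℝ (b j) c ^ 2 ≤ 1 := by
    rw [← hsum]
    exact Finset.single_le_sum (f := fun i => inner ℝ (b i) c ^ 2)
      (fun i _ => by positivity) (Finset.mem_univ j)
  have hrest : ∑ i ∈ Finset.univ.erase j, inner ℝ (b i) c ^ 2 = 1 - inner ℝ (b j) c ^ 2 := by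
    rw [← hsum, ← Finset.add_sum_erase _ _ (Finset.mem_univ j)]; ring
  have hkey : ‖T c‖ ^ 2 ≤ T.singularValues j ^ 2 * inner ℝ (b j) c ^ 2 +
      T.singularValues 0 ^ 2 * (1 - inner ℝ (b j) c ^ 2) := by
    rw [hb c, ← Finset.add_sum_erase _ _ (Finset.mem_univ j), ← hrest, Finset.mul_sum]
    gcongr with i
    · exact T.singularValues_nonneg i
    · exact T.singularValues_antitone (Nat.zero_le i)
  have hd2 : δ ^ 2 ≤ inner ℝ (b j) c ^ 2 := by gcongr
  have hS2 : T.singularValues 0 ^ 2 ≤ (U / δ) ^ 2 := by gcongr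
  have e1 : T.singularValues j ^ 2 * inner ℝ (b j) c ^ 2 ≤ T.singularValues j ^ 2 :=
    mul_le_of_le_one_right (sq_nonneg _) hcj
  have e2 : T.singularValues 0 ^ 2 * (1 - inner ℝ (b j) c ^ 2) ≤ (U / δ) ^ 2 * (1 - δ ^ 2) := by
    gcongr
  have := hlow c hc
  have hjv : (j : ℕ) = k - 1 := rfl
  rw [hjv] at hkey e1
  linarith

end LinearMap

/-! ### The Lambert branch as a function of the exponent -/

section LambertBranch

/-- For `c ≥ 6 / 5` the value `-W₀(-exp (-c))` lies in `(0, 1 / 2]` and solves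
`log t - t = -c`. -/
theorem neg_lambertW0_spec {c : ℝ} (hc : 6 / 5 ≤ c) :
    0 < -lambertW0 (-Real.exp (-c)) ∧ -lambertW0 (-Real.exp (-c)) ≤ 1 / 2 ∧
      Real.log (-lambertW0 (-Real.exp (-c))) - -lambertW0 (-Real.exp (-c)) = -c := by
  have hz : -Real.exp (-1) ≤ -Real.exp (-c) := by
    rw [neg_le_neg_iff]
    exact Real.exp_le_exp.2 (by linarith)
  obtain ⟨h1, h2⟩ := lambertW0_spec hz
  generalize lambertW0 (-Real.exp (-c)) = w at h1 h2
  obtain ⟨t, rfl⟩ : ∃ t, w = -t := ⟨-w, by ring⟩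
  rw [neg_neg]
  have h3 : t * Real.exp (-t) = Real.exp (-c) := by linarith
  have ht : 0 < t := pos_of_mul_pos_left (h3 ▸ Real.exp_pos _) (Real.exp_pos _).le
  have hlog : Real.log t - t = -c := by
    have := congrArg Real.log h3
    rwa [Real.log_mul ht.ne' (Real.exp_pos _).ne', Real.log_exp, Real.log_exp,
      ← sub_eq_add_neg] at this
  refine ⟨ht, ?_, hlog⟩
  by_contra! hlt
  have h4 : Real.log (1 / (2 * t)) ≤ 1 / (2 * t) - 1 := Real.log_le_sub_one_of_pos (by positivity)
  rw [Real.log_div one_ne_zero (by positivity), Real.log_one,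
    Real.log_mul two_ne_zero ht.ne'] at h4
  -- This is `(2 t - 1) (1 - t) ≥ 0`. It gives `log t - t ≥ -(log 2 + 1/2)`, which exceeds `-6/5`:
  -- the constant `6/5` is what forces `t ≤ 1/2`.
  have h5 : 1 / (2 * t) ≤ 3 / 2 - t := by
    rw [div_le_iff₀ (by positivity)]
    nlinarith
  linarith [Real.log_two_lt_d9]

/-- On `(0, 1/2]` the logarithm has slope at least `2`, so `t` absorbs at most half of a change in
`log t`. -/
theorem log_sub_log_le_of_log_sub_self {t₁ t₂ c₁ c₂ : ℝ} (h₁ : 0 < t₁) (h₁' : t₁ ≤ 1 / 2)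
    (h₂ : 0 < t₂) (h₂' : t₂ ≤ 1 / 2) (e₁ : Real.log t₁ - t₁ = -c₁) (e₂ : Real.log t₂ - t₂ = -c₂)
    (hc : c₁ ≤ c₂) :
    0 ≤ Real.log t₁ - Real.log t₂ ∧ Real.log t₁ - Real.log t₂ ≤ 2 * (c₂ - c₁) := by
  have key : ∀ a b : ℝ, 0 < a → 0 < b → a ≤ 1 / 2 → b ≤ a →
      a - b ≤ (Real.log a - Real.log b) / 2 := by
    intro a b ha hb ha' hba
    have h := Real.log_le_sub_one_of_pos (div_pos hb ha)
    have hlog := Real.log_le_log hb hba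
    rw [Real.log_div hb.ne' ha.ne'] at h
    have h2 : a * (b / a) = b := by field_simp
    nlinarith
  rcases le_total t₂ t₁ with h | h
  · have := key t₁ t₂ h₁ h₂ h₁' h
    exact ⟨sub_nonneg.2 (Real.log_le_log h₂ h), by linarith⟩
  · have := key t₂ t₁ h₂ h₁ h₂' h
    have := Real.log_le_log h₁ h
    constructor <;> linarith

theorem continuousOn_neg_lambertW0 :
    ContinuousOn (fun c : ℝ => -lambertW0 (-Real.exp (-c))) (Set.Ici (6 / 5)) := by
  set f : ℝ → ℝ := fun c => -lambertW0 (-Real.exp (-c)) with hf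
  have hlip : LipschitzOnWith 2 (fun c => Real.log (f c)) (Set.Ici (6 / 5)) := by
    apply LipschitzOnWith.of_dist_le_mul
    have key : ∀ x y : ℝ, 6 / 5 ≤ x → 6 / 5 ≤ y → x ≤ y →
        |Real.log (f x) - Real.log (f y)| ≤ 2 * |x - y| := by
      intro x y hx hy hxy
      obtain ⟨a1, a2, a3⟩ := neg_lambertW0_spec hx
      obtain ⟨b1, b2, b3⟩ := neg_lambertW0_spec hy
      obtain ⟨c1, c2⟩ := log_sub_log_le_of_log_sub_self a1 a2 b1 b2 a3 b3 hxy
      rw [abs_of_nonneg c1, abs_sub_comm, abs_of_nonneg (by linarith)]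
      exact c2
    intro x hx y hy
    simp only [Real.dist_eq, NNReal.coe_ofNat]
    rcases le_total x y with h | h
    · exact key x y hx hy h
    · rw [abs_sub_comm, abs_sub_comm x]
      exact key y x hy hx h
  refine (Real.continuous_exp.comp_continuousOn hlip.continuousOn).congr fun c hc => ?_
  exact (Real.exp_log (neg_lambertW0_spec hc).1).symm

end LambertBranch

/-! ### Positivity and attainment of the supremum -/

section Bounds

variable {α lam ε : ℝ}

theorem log_le_muEps (hα : 0 < α) : Real.log (1 + 2 * ε⁻¹) ≤ muEps α ε := by
  unfold muEps; linarith

theorem one_le_muEps (hα : 0 < α) (hε : 0 < ε) (hε1 : ε < 1) : 1 ≤ muEps α ε := by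
  have h1 : (1 : ℝ) < ε⁻¹ := (one_lt_inv₀ hε).2 hε1
  have h2 : Real.log 3 ≤ Real.log (1 + 2 * ε⁻¹) :=
    Real.log_le_log (by norm_num) (by linarith)
  have h3 : 1 ≤ Real.log 3 := by
    rw [Real.le_log_iff_exp_le (by norm_num)]
    linarith [Real.exp_one_lt_d9]
  linarith [log_le_muEps (ε := ε) hα]

/-- `q(μ, λ) = t / (1 - λ)`, where `t ∈ (0, 1 / 2]` solves `log t - t = -2 μ (1 - λ) - 6 / 5`. -/
theorem qBound_spec {μ : ℝ} (hμ : 0 ≤ μ) (hl : lam < 1) :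
    ∃ t : ℝ, 0 < t ∧ t ≤ 1 / 2 ∧ Real.log t - t = -(2 * μ * (1 - lam) + 6 / 5) ∧
      qBound μ lam = (1 - lam)⁻¹ * t := by
  have hy : 0 ≤ 1 - lam := by linarith
  obtain ⟨h1, h2, h3⟩ := neg_lambertW0_spec (c := 2 * μ * (1 - lam) + 6 / 5)
    (by nlinarith [mul_nonneg hμ hy])
  refine ⟨_, h1, h2, h3, ?_⟩
  unfold qBound
  rw [show -2 * μ * (1 - lam) - 6 / 5 = -(2 * μ * (1 - lam) + 6 / 5) by ring]
  ring

theorem rpow_neg_half_eq {y : ℝ} (hy : 0 ≤ y) : y ^ (-(1 / 2) : ℝ) = (Real.sqrt y)⁻¹ := by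
  rw [Real.rpow_neg hy, Real.sqrt_eq_rpow]

theorem continuousOn_pEps (hα : 0 < α) (hl : lam < 1) :
    ContinuousOn (pEps α lam) (Set.Ioo 0 1) := by
  have hmu : ContinuousOn (muEps α) (Set.Ioo 0 1) := by
    unfold muEps
    refine continuousOn_const.add (ContinuousOn.log ?_ ?_)
    · exact continuousOn_const.add (continuousOn_const.mul
        (continuousOn_inv₀.mono fun x hx => hx.1.ne'))
    · intro x hx
      have := inv_pos.2 hx.1
      positivity
  have hq : ContinuousOn (fun ε => qBound (muEps α ε) lam) (Set.Ioo 0 1) := by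
    have h1 : ContinuousOn (fun ε => 2 * muEps α ε * (1 - lam) + 6 / 5) (Set.Ioo 0 1) := by
      fun_prop
    have h2 := continuousOn_neg_lambertW0.comp h1 (fun ε hε => by
      have := one_le_muEps hα hε.1 hε.2
      have : 0 < 1 - lam := by linarith
      simp only [Set.mem_Ici]
      have : 0 ≤ 2 * muEps α ε * (1 - lam) := by positivity
      linarith)
    refine (continuousOn_const.mul h2 : ContinuousOn (fun ε => (1 - lam)⁻¹ * _) _).congr ?_
    intro ε _
    unfold qBound
    simp only [Pi.mul_apply, Function.comp]
    rw [show -2 * muEps α ε * (1 - lam) - 6 / 5 = -(2 * muEps α ε * (1 - lam) + 6 / 5) by ring]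
    ring
  unfold pEps rBound
  fun_prop

open Filter Topology

theorem tendsto_muEps : Tendsto (muEps α) (𝓝[>] 0) atTop := by
  unfold muEps
  refine tendsto_atTop_add_const_left _ _ (Real.tendsto_log_atTop.comp ?_)
  exact tendsto_atTop_add_const_left _ _ (tendsto_inv_nhdsGT_zero.const_mul_atTop two_pos)

theorem rBound_nonneg {μ : ℝ} (hl : lam < 1) : 0 ≤ rBound μ lam := by
  have : 0 ≤ 1 - lam := by linarith
  unfold rBound
  positivity

theorem tendsto_sqrt_qBound (hl : lam < 1) :
    Tendsto (fun μ => Real.sqrt (qBound μ lam)) atTop (𝓝 0) := by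
  have hy : 0 < 1 - lam := by linarith
  have hlim : Tendsto (fun μ : ℝ => Real.sqrt ((1 - lam)⁻¹ *
      Real.exp (-(2 * (1 - lam) * μ)))) atTop (𝓝 0) := by
    have h1 : Tendsto (fun μ : ℝ => 2 * (1 - lam) * μ) atTop atTop :=
      tendsto_id.const_mul_atTop (by positivity)
    have h2 := ((Real.tendsto_exp_neg_atTop_nhds_zero.comp h1).const_mul (1 - lam)⁻¹).sqrt
    simpa [Function.comp_def] using h2
  refine squeeze_zero' (Eventually.of_forall fun _ => Real.sqrt_nonneg _) ?_ hlim
  filter_upwards [eventually_ge_atTop 0] with μ hμ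
  obtain ⟨t, ht, ht2, hlog, hq⟩ := qBound_spec hμ hl
  rw [hq]
  gcongr
  rw [← Real.log_le_iff_le_exp ht]
  linarith

/-- As `ε → 0`, `ε` is comparable to `e^{-μ}`, while `√q` is at least of order `e^{-μ (1 - λ)}`. The
gain `e^{λ μ}` beats `r`, which grows at most linearly in `μ`. -/
theorem exists_pEps_pos (hα : 0 < α) (h0 : 0 < lam) (hl : lam < 1) :
    ∃ ε ∈ Set.Ioo (0 : ℝ) 1, 0 < pEps α lam ε := by
  have hy : 0 < 1 - lam := by linarith
  set K := (1 - lam) ^ (-(1 / 2) : ℝ) + 1 with hK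
  have hK0 : 0 ≤ K := by positivity
  -- The factors bound `ε e^μ` by `3 e^α` and `r` by `(K + 2) μ`; `3/5` is half of the `6/5` in `q`.
  set M := 3 * Real.exp α * Real.exp (3 / 5) * (K + 2) with hM
  have hgrow : ∀ᶠ μ : ℝ in atTop, M * μ < Real.exp (lam * μ) := by
    have h := tendsto_exp_mul_div_rpow_atTop 1 lam h0
    filter_upwards [h.eventually_gt_atTop M, eventually_gt_atTop 0] with μ h1 h2
    rwa [Real.rpow_one, lt_div_iff₀ h2] at h1
  have hev := tendsto_muEps (α := α) |>.eventually hgrow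
  obtain ⟨ε, hμg, hε⟩ := (hev.and (Ioo_mem_nhdsGT (zero_lt_one' ℝ))).exists
  refine ⟨ε, hε, ?_⟩
  have hε0 := hε.1
  have hμ1 := one_le_muEps hα hε.1 hε.2
  have hexpμ : ε * Real.exp (muEps α ε) ≤ 3 * Real.exp α := by
    unfold muEps
    rw [Real.exp_add, Real.exp_log (by positivity)]
    have : ε * (Real.exp α * (1 + 2 * ε⁻¹)) = Real.exp α * (ε + 2) := by field_simp
    rw [this, mul_comm 3]
    gcongr
    linarith [hε.2]
  generalize hμ : muEps α ε = μ at *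
  have hr : rBound μ lam ≤ (K + 2) * μ := by
    have : Real.sqrt (2 * μ) ≤ 2 * μ := by
      rw [Real.sqrt_le_left (by linarith)]
      nlinarith
    unfold rBound
    nlinarith
  obtain ⟨t, ht, ht2, hlog, hq⟩ := qBound_spec (by linarith : (0 : ℝ) ≤ μ) hl
  have hs : Real.exp (-(μ * (1 - lam) + 3 / 5)) ≤ Real.sqrt (qBound μ lam) := by
    apply Real.le_sqrt_of_sq_le
    rw [hq, ← Real.exp_nat_mul]
    have hinv : 1 ≤ (1 - lam)⁻¹ := (one_le_inv₀ hy).2 (by linarith)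
    have : Real.exp ((2 : ℕ) * -(μ * (1 - lam) + 3 / 5)) ≤ t := by
      rw [← Real.le_log_iff_exp_le ht]
      push_cast
      linarith
    nlinarith
  have hmain : ε * rBound μ lam < Real.exp (-(μ * (1 - lam) + 3 / 5)) := by
    have hE : Real.exp (-(μ * (1 - lam) + 3 / 5)) =
        Real.exp (lam * μ) / (Real.exp μ * Real.exp (3 / 5)) := by
      rw [← Real.exp_add, ← Real.exp_sub]
      ring_nf
    rw [hE, lt_div_iff₀ (by positivity)]
    calc ε * rBound μ lam * (Real.exp μ * Real.exp (3 / 5))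
        = (ε * Real.exp μ) * Real.exp (3 / 5) * rBound μ lam := by ring
      _ ≤ (3 * Real.exp α) * Real.exp (3 / 5) * ((K + 2) * μ) := by
          have := rBound_nonneg (μ := μ) hl
          gcongr
      _ = M * μ := by rw [hM]; ring
      _ < _ := hμg
  unfold pEps
  rw [hμ]
  linarith

/-- If `ε r < √q` then `ε ^ 2 < t`, where `q = t / (1 - λ)`. -/
theorem sq_lt_of_mul_rBound_lt {μ t : ℝ} (hl : lam < 1) (hε : 0 < ε)
    (h : ε * rBound μ lam < Real.sqrt ((1 - lam)⁻¹ * t)) : ε ^ 2 < t := by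
  have hy : 0 < 1 - lam := by linarith
  have hsy : 0 < Real.sqrt (1 - lam) := Real.sqrt_pos.2 hy
  rw [Real.sqrt_mul (by positivity), Real.sqrt_inv] at h
  have h1 : (Real.sqrt (1 - lam))⁻¹ ≤ rBound μ lam := by
    unfold rBound
    rw [rpow_neg_half_eq hy.le]
    linarith [Real.sqrt_nonneg (2 * μ)]
  have h2 : ε < Real.sqrt t := by
    have hpos : 0 < (Real.sqrt (1 - lam))⁻¹ := by positivity
    have : (Real.sqrt (1 - lam))⁻¹ * ε < (Real.sqrt (1 - lam))⁻¹ * Real.sqrt t := by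
      nlinarith
    exact lt_of_mul_lt_mul_left this hpos.le
  exact (Real.lt_sqrt hε.le).1 h2

/-- The supremum of `pEps α λ` over `(0, 1)` is attained and positive. -/
theorem exists_isMaxOn_pEps (hα : 0 < α) (h0 : 0 < lam) (hl : lam < 1) :
    ∃ ε ∈ Set.Ioo (0 : ℝ) 1, 0 < pEps α lam ε ∧ IsMaxOn (pEps α lam) (Set.Ioo 0 1) ε := by
  obtain ⟨ε₀, hε₀, hp₀⟩ := exists_pEps_pos hα h0 hl
  have hsmall : ∀ᶠ ε in 𝓝[>] (0 : ℝ), Real.sqrt (qBound (muEps α ε) lam) < pEps α lam ε₀ :=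
    ((tendsto_sqrt_qBound hl).comp tendsto_muEps).eventually_lt_const hp₀
  obtain ⟨δ, hδ, hsm⟩ := mem_nhdsGT_iff_exists_Ioo_subset.1 hsmall
  have hlow : ∀ ε ∈ Set.Ioo (0 : ℝ) 1, ε < δ → pEps α lam ε < pEps α lam ε₀ := by
    intro ε hε hlt
    have h1 : Real.sqrt (qBound (muEps α ε) lam) < pEps α lam ε₀ := hsm ⟨hε.1, hlt⟩
    have h2 := mul_nonneg hε.1.le (rBound_nonneg (μ := muEps α ε) hl)
    have h3 : pEps α lam ε = Real.sqrt (qBound (muEps α ε) lam) - ε * rBound (muEps α ε) lam := rfl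
    linarith
  -- Positivity forces `ε² < t ≤ 1/2`. With the decay of `√q` at `0`, this confines the maximization
  -- to a compact interval.
  have hhigh : ∀ ε ∈ Set.Ioo (0 : ℝ) 1, 0 < pEps α lam ε → ε ≤ 3 / 4 := by
    intro ε hε hp
    obtain ⟨t, ht, ht2, -, hq⟩ := qBound_spec
      (by linarith [one_le_muEps hα hε.1 hε.2] : (0 : ℝ) ≤ muEps α ε) hl
    have h3 : pEps α lam ε = Real.sqrt (qBound (muEps α ε) lam) - ε * rBound (muEps α ε) lam := rfl
    rw [hq] at h3
    have := sq_lt_of_mul_rBound_lt (μ := muEps α ε) (t := t) hl hε.1 (by linarith)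
    nlinarith
  have hε₀δ : δ ≤ ε₀ := by
    by_contra! h
    exact lt_irrefl _ (hlow ε₀ hε₀ h)
  have hδ0 : (0 : ℝ) < δ := hδ
  have hsub : Set.Icc δ (3 / 4) ⊆ Set.Ioo (0 : ℝ) 1 := fun x hx =>
    ⟨hδ0.trans_le hx.1, by linarith [hx.2]⟩
  have hmem₀ : ε₀ ∈ Set.Icc δ (3 / 4) := ⟨hε₀δ, hhigh ε₀ hε₀ hp₀⟩
  obtain ⟨ε, hε, hmax⟩ := isCompact_Icc.exists_isMaxOn ⟨ε₀, hmem₀⟩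
    ((continuousOn_pEps hα hl).mono hsub)
  have hge : pEps α lam ε₀ ≤ pEps α lam ε := hmax hmem₀
  refine ⟨ε, hsub hε, by linarith, fun x hx => ?_⟩
  change pEps α lam x ≤ pEps α lam ε
  rcases lt_or_ge x δ with h | h
  · linarith [hlow x hx h]
  rcases le_or_gt x (3 / 4) with h' | h'
  · exact hmax ⟨h, h'⟩
  · by_contra! hlt
    linarith [hhigh x hx (by linarith)]

end Bounds

/-! ### Consequences of maximality in `ε` -/

section Maximizer

variable {α lam ε : ℝ}

theorem muEps_half_sub_le (hε : 0 < ε) :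
    muEps α ε ≤ muEps α (ε / 2) ∧ muEps α (ε / 2) - muEps α ε ≤ 7 / 10 := by
  have hi : 0 < ε⁻¹ := inv_pos.2 hε
  have h2 : (ε / 2)⁻¹ = 2 * ε⁻¹ := by field_simp
  unfold muEps
  rw [h2]
  have h3 : Real.log (1 + 2 * ε⁻¹) ≤ Real.log (1 + 2 * (2 * ε⁻¹)) :=
    Real.log_le_log (by positivity) (by linarith)
  have h4 : Real.log (1 + 2 * (2 * ε⁻¹)) ≤ Real.log (2 * (1 + 2 * ε⁻¹)) :=
    Real.log_le_log (by positivity) (by linarith)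
  rw [Real.log_mul two_ne_zero (by positivity)] at h4
  constructor <;> linarith [Real.log_two_lt_d9]

/-- At a maximizer `ε` of `pEps α λ`, when `m / n = 1 - λ` is small, `ε r` is a small fraction of
`√q`. -/
theorem mul_rBound_le_of_isMaxOn (hα : 0 < α) (hy : 0 < 1 - lam) (hy' : 1 - lam ≤ 1 / 16)
    (hε : ε ∈ Set.Ioo (0 : ℝ) 1) (hmax : IsMaxOn (pEps α lam) (Set.Ioo 0 1) ε) :
    ε * rBound (muEps α ε) lam ≤ 1 / 2 * Real.sqrt (qBound (muEps α ε) lam) := by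
  have hl : lam < 1 := by linarith
  have hε2 : ε / 2 ∈ Set.Ioo (0 : ℝ) 1 := ⟨by linarith [hε.1], by linarith [hε.1, hε.2]⟩
  have hle : pEps α lam (ε / 2) ≤ pEps α lam ε := hmax hε2
  obtain ⟨hm1, hm2⟩ := muEps_half_sub_le (α := α) hε.1
  have hμ1 := one_le_muEps hα hε.1 hε.2
  have hε0 := hε.1
  unfold pEps at hle
  generalize muEps α (ε / 2) = ν at hle hm1 hm2
  generalize muEps α ε = μ at *
  obtain ⟨t, ht, ht2, hlog, hq⟩ := qBound_spec (by linarith : (0 : ℝ) ≤ μ) hl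
  obtain ⟨u, hu, hu2, hlogu, hqu⟩ := qBound_spec (by linarith : (0 : ℝ) ≤ ν) hl
  have hd : (ν - μ) * (1 - lam) ≤ 7 / 10 * (1 / 16) := by gcongr
  have hlogs := (log_sub_log_le_of_log_sub_self ht ht2 hu hu2 hlog hlogu (by nlinarith)).2
  have hut : t * (4 / 5) ^ 2 ≤ u := by
    have h1 : Real.log t - Real.log u ≤ 36 / 100 := by linarith
    -- The bound `36/100` is `1 - (4/5)²`, so `1 - u/t ≤ log (t/u)` gives `u/t ≥ (4/5)²`.
    have h2 : Real.log (t / u) = Real.log t - Real.log u := Real.log_div ht.ne' hu.ne'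
    have h3 := Real.one_sub_inv_le_log_of_pos (div_pos ht hu)
    rw [h2, inv_div] at h3
    have h4 : 64 / 100 ≤ u / t := by linarith
    rw [le_div_iff₀ ht] at h4
    linarith
  have hs : 4 / 5 * Real.sqrt (qBound μ lam) ≤ Real.sqrt (qBound ν lam) := by
    apply Real.le_sqrt_of_sq_le
    have hinv : 0 < (1 - lam)⁻¹ := inv_pos.2 hy
    rw [mul_pow, Real.sq_sqrt (by rw [hq]; positivity), hq, hqu]
    nlinarith
  have hb : Real.sqrt (2 * ν) ≤ Real.sqrt (2 * μ) + 7 / 10 := by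
    have h1 : 1 ≤ Real.sqrt (2 * μ) := Real.one_le_sqrt.2 (by linarith)
    rw [Real.sqrt_le_left (by positivity)]
    nlinarith [Real.sq_sqrt (show (0 : ℝ) ≤ 2 * μ by linarith)]
  have h4 : 4 ≤ (1 - lam) ^ (-(1 / 2) : ℝ) := by
    rw [rpow_neg_half_eq hy.le, le_inv_comm₀ (by norm_num) (Real.sqrt_pos.2 hy),
      Real.sqrt_le_left (by norm_num)]
    linarith
  have hr : rBound ν lam ≤ 6 / 5 * rBound μ lam := by
    unfold rBound
    linarith [Real.sqrt_nonneg (2 * μ)]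
  -- Maximality now reads `(4/5) √q - (3/5) ε r ≤ √q - ε r`, that is `ε r ≤ √q / 2`.
  have : ε / 2 * rBound ν lam ≤ ε / 2 * (6 / 5 * rBound μ lam) := by gcongr
  linarith

/-- The second-order lower bound for the squared smallest singular value is at least
`pEps α λ ε ^ 2` at a maximizer `ε`. -/
theorem sq_pEps_le_of_isMaxOn (hα : 0 < α) (h0 : 0 < lam) (hl : lam < 1)
    (hε : ε ∈ Set.Ioo (0 : ℝ) 1) (hp : 0 < pEps α lam ε)
    (hmax : IsMaxOn (pEps α lam) (Set.Ioo 0 1) ε) :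
    pEps α lam ε ^ 2 ≤ qBound (muEps α ε) lam -
      ((rBound (muEps α ε) lam - 1) / (1 - ε ^ 2 / 2)) ^ 2 * (1 - (1 - ε ^ 2 / 2) ^ 2) := by
  have hy : 0 < 1 - lam := by linarith
  have hε0 := hε.1
  have hopt := fun h => mul_rBound_le_of_isMaxOn hα hy h hε hmax
  have hμ1 := one_le_muEps hα hε.1 hε.2
  unfold pEps at hp ⊢
  generalize muEps α ε = μ at *
  obtain ⟨t, ht, ht2, -, hq⟩ := qBound_spec (by linarith : (0 : ℝ) ≤ μ) hl
  have hεt := sq_lt_of_mul_rBound_lt (t := t) (μ := μ) hl hε0 (by rw [← hq]; linarith)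
  set δ := 1 - ε ^ 2 / 2 with hδ
  have hδ34 : 3 / 4 ≤ δ := by linarith
  set h := (1 - lam) ^ (-(1 / 2) : ℝ) with hh
  have hhpos : 0 < h := by positivity
  have hh2 : h ^ 2 * (1 - lam) = 1 := by
    rw [hh, rpow_neg_half_eq hy.le, inv_pow, Real.sq_sqrt hy.le]
    field_simp
  have hrdef : rBound μ lam = h + 1 + Real.sqrt (2 * μ) := rfl
  have hrh : h + 1 ≤ rBound μ lam := by rw [hrdef]; linarith [Real.sqrt_nonneg (2 * μ)]
  have hqs : qBound μ lam = Real.sqrt (qBound μ lam) ^ 2 := by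
    rw [Real.sq_sqrt]
    rw [hq]; positivity
  have hqh : qBound μ lam = h ^ 2 * t := by
    rw [hq]
    congr 1
    field_simp
    linarith
  set s := Real.sqrt (qBound μ lam) with hs
  set r := rBound μ lam with hr
  have hs0 : 0 < s := by
    have : 0 < ε * r := mul_pos hε0 (by linarith)
    linarith
  have hr1 : 0 < r - 1 := by linarith
  -- Obtained by expanding `(s - ε r)²`, using `1 - δ² ≤ ε²` and dividing by `ε`.
  have hsuff : ε * (((r - 1) / δ) ^ 2 + r ^ 2) ≤ 2 * s * r := by
    rcases le_or_gt (r - 1) (δ * r) with hc | hc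
    · have h1 : (r - 1) / δ ≤ r := by
        rw [div_le_iff₀ (by linarith)]; linarith
      have h2 : ((r - 1) / δ) ^ 2 ≤ r ^ 2 := by gcongr
      have h3 : ε * (((r - 1) / δ) ^ 2 + r ^ 2) ≤ ε * (r ^ 2 + r ^ 2) := by gcongr
      have h4 : ε * r * (2 * r) ≤ s * (2 * r) :=
        mul_le_mul_of_nonneg_right (by linarith) (by linarith)
      linarith
    -- Here `ε² r > 2`; with `ε r < s`, `ε² < t` and `t ≤ 1/2` this forces `h² > 16`, so maximality
    -- applies. Then `(16/9 + 1) / 2 ≤ 2` closes the case.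
    · have hbig : 2 < ε * (ε * r) := by rw [hδ] at hc; linarith
      have h1 : 2 < ε * s := hbig.trans_le (mul_le_mul_of_nonneg_left (by linarith) hε0.le)
      have h2 : 4 < ε ^ 2 * s ^ 2 := by
        rw [← mul_pow, show (4 : ℝ) = 2 ^ 2 by norm_num]
        gcongr
      have h3 : 4 < h ^ 2 * t ^ 2 := by
        have : ε ^ 2 * s ^ 2 ≤ t * s ^ 2 := by gcongr
        have hst : t * s ^ 2 = h ^ 2 * t ^ 2 := by rw [← hqs, hqh]; ring
        linarith
      have h4 : 16 < h ^ 2 := by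
        have : h ^ 2 * t ^ 2 ≤ h ^ 2 * (1 / 2) ^ 2 := by gcongr
        linarith
      have hy16 : 1 - lam ≤ 1 / 16 := by nlinarith
      have hκ := hopt hy16
      have h5 : (r - 1) / δ ≤ 4 / 3 * r := by
        rw [div_le_iff₀ (by linarith)]
        have : 4 / 3 * r * (3 / 4) ≤ 4 / 3 * r * δ :=
          mul_le_mul_of_nonneg_left hδ34 (by linarith)
        linarith
      have h6 : ((r - 1) / δ) ^ 2 ≤ (4 / 3 * r) ^ 2 := by gcongr
      have h7 : ε * (((r - 1) / δ) ^ 2 + r ^ 2) ≤ ε * ((4 / 3 * r) ^ 2 + r ^ 2) := by gcongr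
      have h8 : ε * r * r ≤ 1 / 2 * s * r := mul_le_mul_of_nonneg_right hκ (by linarith)
      have h9 : 0 ≤ s * r := mul_nonneg hs0.le (by linarith)
      linarith
  have h8 : ((r - 1) / δ) ^ 2 * (1 - δ ^ 2) ≤ ((r - 1) / δ) ^ 2 * ε ^ 2 := by
    gcongr
    rw [hδ]
    nlinarith [sq_nonneg (ε ^ 2)]
  have h9 := mul_le_mul_of_nonneg_left hsuff hε0.le
  have h10 : (s - ε * r) ^ 2 = s ^ 2 - ε * (2 * s * r) + ε * (ε * r ^ 2) := by ring
  rw [hqs, h10]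
  linarith

end Maximizer

/-! ### Union bounds over the net -/

section GaussianMatrix

variable {Ω : Type*} [MeasurableSpace Ω] {P : Measure Ω} {n m : ℕ}
  {A : Ω → Matrix (Fin n) (Fin m) ℝ}

theorem sq_norm_toEuclideanLin (B : Matrix (Fin n) (Fin m) ℝ) (x : EuclideanSpace ℝ (Fin m)) :
    ‖Matrix.toEuclideanLin B x‖ ^ 2 = ∑ i, (∑ j, B i j * x j) ^ 2 := by
  rw [EuclideanSpace.norm_sq_eq]
  simp [Matrix.toLpLin_apply, Matrix.mulVec, dotProduct]

theorem measureReal_sq_norm_toEuclideanLin_le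
    (hlaw : ∀ i j, HasLaw (fun ω => A ω i j) (gaussianReal 0 1) P)
    (hindep : iIndepFun (fun (ij : Fin n × Fin m) (ω : Ω) => A ω ij.1 ij.2) P)
    {x : EuclideanSpace ℝ (Fin m)} (hx : ‖x‖ = 1) {t : ℝ} (ht : 0 < t) (ht1 : t ≤ 1) :
    P.real {ω | ‖Matrix.toEuclideanLin (A ω) x‖ ^ 2 ≤ t * n} ≤
      Real.exp ((1 - t + Real.log t) / 2 * n) := by
  have hx2 : ∑ j, x j ^ 2 = 1 := by
    have := EuclideanSpace.norm_sq_eq x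
    simp only [Real.norm_eq_abs, sq_abs, hx] at this
    linarith
  have hrow : ∀ i, iIndepFun (fun j ω => A ω i j) P := fun i =>
    hindep.precomp (g := fun j => (i, j)) (fun a b h => (Prod.mk.inj h).2)
  have := measureReal_sum_sq_gaussian_le
    (fun i => hasLaw_sum_mul_gaussianReal (hlaw i) (hrow i) x hx2)
    (iIndepFun_sum_mul_row hlaw hindep x) ht ht1
  simpa only [sq_norm_toEuclideanLin, Fintype.card_fin] using this

theorem measureReal_add_sq_le_sq_norm_toEuclideanLin (hn : 0 < n)
    (hlaw : ∀ i j, HasLaw (fun ω => A ω i j) (gaussianReal 0 1) P)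
    (hindep : iIndepFun (fun (ij : Fin n × Fin m) (ω : Ω) => A ω ij.1 ij.2) P)
    {x : EuclideanSpace ℝ (Fin m)} (hx : ‖x‖ = 1) {τ : ℝ} (hτ : 0 ≤ τ) :
    P.real {ω | Real.sqrt n + τ ≤ ‖Matrix.toEuclideanLin (A ω) x‖} ≤ Real.exp (-τ ^ 2 / 2) := by
  have : Nonempty (Fin n) := ⟨⟨0, hn⟩⟩
  have hx2 : ∑ j, x j ^ 2 = 1 := by
    have := EuclideanSpace.norm_sq_eq x
    simp only [Real.norm_eq_abs, sq_abs, hx] at this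
    linarith
  have hrow : ∀ i, iIndepFun (fun j ω => A ω i j) P := fun i =>
    hindep.precomp (g := fun j => (i, j)) (fun a b h => (Prod.mk.inj h).2)
  have := measureReal_add_sq_le_sum_sq_gaussian
    (fun i => hasLaw_sum_mul_gaussianReal (hlaw i) (hrow i) x hx2)
    (iIndepFun_sum_mul_row hlaw hindep x) hτ
  simp only [← sq_norm_toEuclideanLin, Fintype.card_fin] at this
  convert this using 4 with ω
  exact (sq_le_sq₀ (by positivity) (norm_nonneg _)).symm

theorem measureReal_biUnion_finset_le_card_mul {ι : Type*} [IsFiniteMeasure P] (s : Finset ι)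
    (B : ι → Set Ω) {b N : ℝ} (hb : 0 ≤ b) (hN : (s.card : ℝ) ≤ N) (h : ∀ i ∈ s, P.real (B i) ≤ b) :
    P.real (⋃ i ∈ s, B i) ≤ N * b :=
  calc P.real (⋃ i ∈ s, B i) ≤ ∑ i ∈ s, P.real (B i) := measureReal_biUnion_finset_le s B
    _ ≤ ∑ _i ∈ s, b := Finset.sum_le_sum h
    _ = s.card * b := by simp
    _ ≤ N * b := by gcongr

/-- The tail bound for the smallest singular value at a maximizer of `pEps α λ`. -/
theorem measureReal_sMin_le_of_isMaxOn [IsProbabilityMeasure P] (hm : 1 ≤ m) (hnm : m < n)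
    (hlaw : ∀ i j, HasLaw (fun ω => A ω i j) (gaussianReal 0 1) P)
    (hindep : iIndepFun (fun (ij : Fin n × Fin m) (ω : Ω) => A ω ij.1 ij.2) P)
    {lam α ε : ℝ} (hlam : lam = 1 - (m : ℝ) / (n : ℝ)) (h0 : 0 < lam) (hl : lam < 1) (hα : 0 < α)
    (hε : ε ∈ Set.Ioo (0 : ℝ) 1) (hp : 0 < pEps α lam ε)
    (hmax : IsMaxOn (pEps α lam) (Set.Ioo 0 1) ε) :
    P.real {ω | sMin (A ω) ≤ pEps α lam ε * Real.sqrt m} ≤ 2 * Real.exp (-α * m) := by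
  have hm0 : (0 : ℝ) < m := by exact_mod_cast hm
  have hn0 : (0 : ℝ) < n := by exact_mod_cast (by omega : 0 < n)
  have hyn : (1 - lam) * n = m := by rw [hlam]; field_simp; ring
  have hμ1 := one_le_muEps hα hε.1 hε.2
  have hsq := sq_pEps_le_of_isMaxOn hα h0 hl hε hp hmax
  obtain ⟨t, ht, ht2, hlog, hq⟩ := qBound_spec
    (by linarith : (0 : ℝ) ≤ muEps α ε) hl
  have hy : 0 < 1 - lam := by linarith
  obtain ⟨s, hs1, hcard, hnet⟩ := exists_sphere_net (E := EuclideanSpace ℝ (Fin m)) hε.1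
  rw [finrank_euclideanSpace_fin] at hcard
  have hcount : (1 + 2 * ε⁻¹) ^ m * Real.exp (-(muEps α ε * m)) = Real.exp (-α * m) := by
    have hpos : 0 < 1 + 2 * ε⁻¹ := by
      have := inv_pos.2 hε.1
      positivity
    rw [← Real.exp_log (pow_pos hpos m), ← Real.exp_add, Real.log_pow]
    unfold muEps
    ring_nf
  have htq : t * n = qBound (muEps α ε) lam * m := by
    rw [hq, ← hyn]
    field_simp
  set τ := Real.sqrt (2 * muEps α ε * m) with hτ
  have hτ2 : τ ^ 2 = 2 * muEps α ε * m := Real.sq_sqrt (by positivity)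
  -- The upper tail needs only `r - 1`; the spare `1` in `r` compensates the division by `δ`.
  have hU : (rBound (muEps α ε) lam - 1) * Real.sqrt m = Real.sqrt n + τ := by
    have h1 : (1 - lam) ^ (-(1 / 2) : ℝ) * Real.sqrt m = Real.sqrt n := by
      rw [rpow_neg_half_eq hy.le, ← hyn, Real.sqrt_mul hy.le]
      have := Real.sqrt_pos.2 hy
      field_simp
    have h2 : Real.sqrt (2 * muEps α ε) * Real.sqrt m = τ := by
      rw [hτ, Real.sqrt_mul (by positivity : (0 : ℝ) ≤ 2 * muEps α ε)]
    unfold rBound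
    rw [← h1, ← h2]
    ring
  let B₁ : EuclideanSpace ℝ (Fin m) → Set Ω := fun c =>
    {ω | ‖Matrix.toEuclideanLin (A ω) c‖ ^ 2 ≤ t * n}
  let B₂ : EuclideanSpace ℝ (Fin m) → Set Ω := fun c =>
    {ω | Real.sqrt n + τ ≤ ‖Matrix.toEuclideanLin (A ω) c‖}
  have hB₁ : P.real (⋃ c ∈ s, B₁ c) ≤ Real.exp (-α * m) := by
    rw [← hcount]
    refine measureReal_biUnion_finset_le_card_mul s B₁ (Real.exp_pos _).le hcard fun c hc => ?_
    refine (measureReal_sq_norm_toEuclideanLin_le hlaw hindep (hs1 c hc) ht (by linarith)).trans ?_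
    rw [Real.exp_le_exp]
    -- Since `6/5 = 1 + 1/5`, a surplus `-n/10` remains and is discarded.
    have : (1 - t + Real.log t) / 2 * n = -(n / 10) - muEps α ε * ((1 - lam) * n) := by
      rw [show 1 - t + Real.log t = 1 + (Real.log t - t) by ring, hlog]; ring
    rw [this, hyn]
    linarith
  have hB₂ : P.real (⋃ c ∈ s, B₂ c) ≤ Real.exp (-α * m) := by
    rw [← hcount]
    refine measureReal_biUnion_finset_le_card_mul s B₂ (Real.exp_pos _).le hcard fun c hc => ?_
    refine (measureReal_add_sq_le_sq_norm_toEuclideanLin (by omega) hlaw hindep (hs1 c hc)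
      (Real.sqrt_nonneg _)).trans (le_of_eq ?_)
    rw [hτ2]
    ring_nf
  have hsub : {ω | sMin (A ω) ≤ pEps α lam ε * Real.sqrt m} ⊆
      (⋃ c ∈ s, B₁ c) ∪ (⋃ c ∈ s, B₂ c) := by
    intro ω hω
    by_contra hnot
    simp only [Set.mem_union, Set.mem_iUnion, not_or, not_exists, B₁, B₂, Set.mem_ofPred_eq,
      not_le] at hnot
    have h1 := (Matrix.toEuclideanLin (A ω)).lt_sq_singularValues_of_net
      (finrank_euclideanSpace_fin (𝕜 := ℝ) (n := m)) hm hε.2 hε.1 s hs1 hnet hnot.1 hnot.2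
    have hmin : sMin (A ω) = (Matrix.toEuclideanLin (A ω)).singularValues (m - 1) := by
      unfold sMin
      rw [min_eq_right hnm.le]
    rw [← hmin, htq, ← hU] at h1
    have h2 : sMin (A ω) ^ 2 ≤ (pEps α lam ε * Real.sqrt m) ^ 2 := by
      have : 0 ≤ sMin (A ω) := LinearMap.singularValues_nonneg _ _
      have : sMin (A ω) ≤ pEps α lam ε * Real.sqrt m := hω
      gcongr
    have hmsq : Real.sqrt m ^ 2 = m := Real.sq_sqrt hm0.le
    have h3 := mul_le_mul_of_nonneg_right hsq hm0.le
    rw [mul_pow, hmsq] at h2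
    rw [mul_div_right_comm, mul_pow, hmsq] at h1
    linarith
  calc P.real {ω | sMin (A ω) ≤ pEps α lam ε * Real.sqrt m}
      ≤ P.real ((⋃ c ∈ s, B₁ c) ∪ (⋃ c ∈ s, B₂ c)) := measureReal_mono hsub
    _ ≤ P.real (⋃ c ∈ s, B₁ c) + P.real (⋃ c ∈ s, B₂ c) := measureReal_union_le _ _
    _ ≤ 2 * Real.exp (-α * m) := by linarith

end GaussianMatrix

theorem theorem4p6 {Ω : Type*} [MeasurableSpace Ω] (P : Measure Ω) [IsProbabilityMeasure P]
    (n m : ℕ) (hm : 1 ≤ m) (hnm : m < n)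
    (A : Ω → Matrix (Fin n) (Fin m) ℝ)
    (hlaw : ∀ i j, HasLaw (fun ω => A ω i j) (gaussianReal 0 1) P)
    (hindep : iIndepFun (fun (ij : Fin n × Fin m) (ω : Ω) => A ω ij.1 ij.2) P)
    (lam : ℝ) (hlam : lam = 1 - (m : ℝ) / (n : ℝ))
    (α : ℝ) (hα : 0 < α) :
    IsLUB (pEps α lam '' Set.Ioo 0 1) (pBound α lam) ∧
      0 < pBound α lam ∧
      P.real {ω | sMin (A ω) ≤ pBound α lam * Real.sqrt m} ≤ 2 * Real.exp (-α * m) := by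
  have hm0 : (0 : ℝ) < m := by exact_mod_cast hm
  have hmn : (m : ℝ) < n := by exact_mod_cast hnm
  have hn0 : (0 : ℝ) < n := hm0.trans hmn
  have h0 : 0 < lam := by
    rw [hlam, sub_pos, div_lt_one hn0]
    exact hmn
  have hl : lam < 1 := by
    have : 0 < (m : ℝ) / n := by positivity
    linarith
  obtain ⟨ε, hε, hp, hmax⟩ := exists_isMaxOn_pEps hα h0 hl
  have hgreatest : IsGreatest (pEps α lam '' Set.Ioo 0 1) (pEps α lam ε) :=
    ⟨Set.mem_image_of_mem _ hε, by rintro _ ⟨x, hx, rfl⟩; exact hmax hx⟩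
  have heq : pBound α lam = pEps α lam ε := hgreatest.csSup_eq
  rw [heq]
  exact ⟨hgreatest.isLUB, hp,
    measureReal_sMin_le_of_isMaxOn hm hnm hlaw hindep hlam h0 hl hα hε hp hmax⟩
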